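/- Let $F$ be a field of characteristic $0$ and let $H$ be a Hopf algebra over $F$ (not necessarily finite dimensional) whose antipode $S$ satisfies $S^2=\mathrm{id}_H$. Let $L$ be a finite dimensional (right) $H$-comodule Lie algebra over $F$, i.e. a finite dimensional Lie algebra that is a right $H$-comodule via $\rho\colon L\to L\otimes H$, $\rho(a)=a_{(0)}\otimes a_{(1)}$, such that $\rho([a,b])=[a_{(0)},b_{(0)}]\otimes a_{(1)}b_{(1)}$ for all $a,b\in L$. Then the solvable radical $R$ of $L$ (its largest solvable ideal) and the nilpotent radical $N$ of $L$ (its largest nilpotent ideal) are $H$-subcomodules of $L$, i.e. $\rho(R)\subseteq R\otimes H$ and $\rho(N)\subseteq N\otimes H$. -/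

import Mathlib

open scoped TensorProduct

noncomputable section

/-- A right comodule structure on the `F`-module `V` over the coalgebra `H`: a coassociative and
counital `F`-linear map `V → V ⊗ H`. -/
structure RightComodule (F H V : Type*) [CommRing F] [AddCommGroup H] [Module F H] [Coalgebra F H]
    [AddCommGroup V] [Module F V] where
  /-- The comodule map `ρ`. -/
  coact : V →ₗ[F] V ⊗[F] H
  /-- `(ρ ⊗ id) ρ = (id ⊗ Δ) ρ`, up to the associativity of the tensor product. -/
  coact_coassoc :
    (TensorProduct.assoc F V H H).toLinearMap ∘ₗ coact.rTensor H ∘ₗ coact =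
      (Coalgebra.comul (R := F) (A := H)).lTensor V ∘ₗ coact
  /-- `(id ⊗ ε) ρ = id`, up to the identification of `V ⊗ F` with `V`. -/
  coact_counit :
    (TensorProduct.rid F V).toLinearMap ∘ₗ (Coalgebra.counit (R := F) (A := H)).lTensor V ∘ₗ coact =
      LinearMap.id

/-- The submodule `W` of `V` is an `H`-subcomodule: `ρ(W)` lies in (the image in `V ⊗ H` of)
`W ⊗ H`. -/
def RightComodule.IsSubcomodule {F H V : Type*} [CommRing F] [AddCommGroup H] [Module F H]
    [Coalgebra F H] [AddCommGroup V] [Module F V] (C : RightComodule F H V)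
    (W : Submodule F V) : Prop :=
  ∀ w ∈ W, C.coact w ∈ LinearMap.range (W.subtype.rTensor H)

/-- The bilinear product on `L ⊗ H` with `(a ⊗ h, b ⊗ k) ↦ [a, b] ⊗ h k`, as a linear map on
`(L ⊗ H) ⊗ (L ⊗ H)`. -/
def lieTensorMul (F H L : Type*) [CommRing F] [Ring H] [Algebra F H] [LieRing L]
    [LieAlgebra F L] : (L ⊗[F] H) ⊗[F] (L ⊗[F] H) →ₗ[F] L ⊗[F] H :=
  TensorProduct.map (LieModule.toModuleHom F L L : L ⊗[F] L →ₗ[F] L) (LinearMap.mul' F H) ∘ₗ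
    (TensorProduct.tensorTensorTensorComm F L H L H).toLinearMap

theorem lieTensorMul_tmul (F H L : Type*) [CommRing F] [Ring H] [Algebra F H] [LieRing L]
    [LieAlgebra F L] (a b : L) (h k : H) :
    lieTensorMul F H L ((a ⊗ₜ[F] h) ⊗ₜ[F] (b ⊗ₜ[F] k)) = ⁅a, b⁆ ⊗ₜ[F] (h * k) := by
  simp [lieTensorMul]

/-- A (right) `H`-comodule Lie algebra structure on the Lie algebra `L`: a right `H`-comodule
structure with `ρ([a, b]) = [a₀, b₀] ⊗ a₁ b₁`. -/
structure ComoduleLieAlgebra (F H L : Type*) [CommRing F] [Ring H] [Bialgebra F H] [LieRing L]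
    [LieAlgebra F L] extends RightComodule F H L where
  /-- Compatibility of the comodule map with the bracket of `L` and the product of `H`. -/
  coact_lie : ∀ a b : L, coact ⁅a, b⁆ = lieTensorMul F H L (coact a ⊗ₜ[F] coact b)

/-- The nilpotent radical: the largest ideal of `L` that is nilpotent as a Lie algebra, defined as
the supremum of all such ideals. It differs from `LieAlgebra.maxNilpotentIdeal`, which
asks for ideals that are nilpotent as `L`-modules. -/
def LieAlgebra.nilpotentRadical (F L : Type*) [CommRing F] [LieRing L] [LieAlgebra F L] :
    LieIdeal F L :=
  sSup {I : LieIdeal F L | LieRing.IsNilpotent I}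

end

/-! The plan is to describe `N` by traces and to read off `R` from `N`. In characteristic zero, `a ∈
N` iff `tr (ad a ∘ u) = 0` for every `u` in the associative algebra generated by `ad L`
(`mem_nilpotentRadical_iff`), and `a ∈ R` iff `[a, L] ⊆ N`, because `[L, R]` acts nilpotently.

Let `c` be the coefficient matrix of `ρ` in a basis of `L`; it is invertible with inverse `S(c)`.
Compatibility with the bracket says that `ad a₀ ⊗ a₁` has matrix `c · ad a · S(c)`. Every `ad b` is
an `H`-combination of such conjugates, so multiplying this matrix by `u` gives a sum of terms `c ·
(ad a ∘ w) · S(c) · h`. Since `S² = id`, the trace of such a term is `tr (ad a ∘ w) h`, which is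
zero for `a ∈ N`. Hence `tr (ad a₀ ∘ u) a₁ = 0` for all `u`, which is `ρ(a) ∈ N ⊗ H`.

For `a ∈ R`, each `ρ([a, b])` lies in `N ⊗ H`; cancelling the coaction on `b` with `S` puts `[a₀, b]
⊗ a₁` there too. -/

section TracePowers

/-! ### Nilpotency from traces of powers -/

open Polynomial in
/-- In characteristic zero, an endomorphism of a finite dimensional space all of whose positive
powers have trace zero is nilpotent. -/
theorem LinearMap.isNilpotent_of_forall_trace_pow_eq_zero {F V : Type*} [Field F] [CharZero F]
    [AddCommGroup V] [Module F V] [FiniteDimensional F V] (f : Module.End F V)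
    (h : ∀ k : ℕ, LinearMap.trace F V (f ^ (k + 1)) = 0) : IsNilpotent f := by
  obtain ⟨q, hq, hXq⟩ := exists_eq_pow_rootMultiplicity_mul_and_not_dvd (minpoly F f)
    (minpoly.ne_zero (Algebra.IsIntegral.isIntegral f)) 0
  set m := (minpoly F f).rootMultiplicity 0
  rw [C_0, sub_zero] at hq hXq
  have hcop : IsCoprime (X ^ (m + 1) : F[X]) q :=
    ((irreducible_X.coprime_iff_not_dvd).2 hXq).pow_left
  obtain ⟨s, t, hst⟩ := hcop
  have hann : f ^ m * aeval f q = 0 := by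
    simpa [hq] using minpoly.aeval F f
  -- The Fitting projection onto the part where `f` is invertible. The exponent `m + 1`, not `m`,
  -- removes the constant term even when `m = 0`, so the trace hypothesis applies.
  set e : Module.End F V := aeval f (s * X ^ (m + 1)) with he
  have hsum : e + aeval f (t * q) = 1 := by
    rw [he, ← map_add, hst, map_one]
  have hmul : e * aeval f (t * q) = 0 := by
    have : s * X ^ (m + 1) * (t * q) = (s * t * X) * (X ^ m * q) := by ring
    rw [he, ← map_mul, this, map_mul, map_mul (aeval f) (X ^ m), map_pow, aeval_X, hann, mul_zero]
  have hidem : IsIdempotentElem e := by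
    have := congrArg (e * ·) hsum
    rwa [mul_add, hmul, add_zero, mul_one] at this
  have htr : LinearMap.trace F V e = 0 := by
    have : ∀ p : F[X], LinearMap.trace F V (aeval f (p * X ^ (m + 1))) = 0 := by
      intro p
      induction p using Polynomial.induction_on' with
      | add p q hp hq => rw [add_mul, map_add, map_add, hp, hq, add_zero]
      | monomial n a =>
        rw [← C_mul_X_pow_eq_monomial, mul_assoc, ← pow_add, map_mul, aeval_C, map_pow, aeval_X,
          ← Algebra.smul_def, map_smul, ← add_assoc, h, smul_zero]
    exact this s
  have he0 : e = 0 := LinearMap.IsIdempotentElem.eq_zero_of_trace_eq_zero hidem htr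
  refine ⟨m, ?_⟩
  rw [he0, zero_add] at hsum
  calc f ^ m = f ^ m * aeval f (q * t) := by rw [mul_comm, hsum, mul_one]
    _ = 0 := by rw [map_mul, ← mul_assoc, hann, zero_mul]

end TracePowers

/-! ### Nilpotent action of `[L, I]` for a solvable ideal `I` -/

namespace LieModule

open LieAlgebra

/-- Over an algebraically closed field of characteristic zero, `⁅L, I⁆` acts by nilpotent
endomorphisms on every finite dimensional `L`-module when `I` is a solvable ideal. -/
theorem isNilpotent_toEnd_of_mem_lie_top_of_isAlgClosed {K L : Type*} [Field K] [CharZero K]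
    [IsAlgClosed K] [LieRing L] [LieAlgebra K L] (I : LieIdeal K L) [IsSolvable I] {z : L}
    (hz : z ∈ ⁅(⊤ : LieIdeal K L), I⁆) (V : Type*) [AddCommGroup V] [Module K V]
    [FiniteDimensional K V] [LieRingModule L V] [LieModule K L V] :
    _root_.IsNilpotent (toEnd K L V z) := by
  induction hn : Module.finrank K V using Nat.strong_induction_on generalizing V with
  | _ n ih =>
  obtain hV | hV := subsingleton_or_nontrivial V
  · exact ⟨1, Subsingleton.elim _ _⟩
  obtain ⟨χ, hχ⟩ := exists_nontrivial_weightSpace_of_isSolvable K I V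
  let W : LieSubmodule K L V := weightSpaceOfIsLieTower K V (χ : I → K)
  have hW : Nontrivial W := hχ
  have hzI : z ∈ I := LieSubmodule.lie_le_right I ⊤ hz
  have hact : ∀ a (ha : a ∈ I), toEnd K L W a = χ ⟨a, ha⟩ • (1 : Module.End K W) := by
    intro a ha
    ext ⟨w, hw⟩
    exact (mem_weightSpace (M := V) (χ : I → K) w).1 hw ⟨a, ha⟩
  -- The weight space `W` is stable under all of `L`, so `z` acts on it as a sum of commutators;
  -- being also the scalar `χ z`, it acts by zero in characteristic zero.
  have htr : LinearMap.trace K W (toEnd K L W z) = 0 := by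
    clear ih hzI
    rw [← LieSubmodule.mem_toSubmodule, LieSubmodule.lieIdeal_oper_eq_linear_span'] at hz
    induction hz using Submodule.span_induction with
    | mem x hx =>
      obtain ⟨y, -, a, -, rfl⟩ := hx
      have hlie : toEnd K L W ⁅y, a⁆ =
          toEnd K L W y * toEnd K L W a - toEnd K L W a * toEnd K L W y := by
        ext w
        simp
      rw [hlie, map_sub, LinearMap.trace_mul_comm, sub_self]
    | zero => simp
    | add x y _ _ hx hy => rw [map_add, map_add, hx, hy, add_zero]
    | smul c x _ hx => rw [map_smul, map_smul, hx, smul_zero]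
  have hχz : χ ⟨z, hzI⟩ = 0 := by
    rw [hact z hzI, map_smul, LinearMap.trace_one, smul_eq_mul, mul_eq_zero] at htr
    refine htr.resolve_right ?_
    exact_mod_cast (Module.finrank_pos (R := K) (M := W)).ne'
  have hlt : Module.finrank K (V ⧸ W) < n := by
    have h1 := Submodule.finrank_quotient_add_finrank (W : Submodule K V)
    have h2 : 0 < Module.finrank K (W : Submodule K V) := Module.finrank_pos (R := K) (M := W)
    change Module.finrank K (V ⧸ (W : Submodule K V)) < n
    omega
  obtain ⟨k, hk⟩ := ih _ hlt (V ⧸ W) rfl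
  refine ⟨k + 1, ?_⟩
  ext v
  have hmk : ∀ j (v : V), LieSubmodule.Quotient.mk (N := W) ((toEnd K L V z ^ j) v) =
      (toEnd K L (V ⧸ W) z ^ j) (LieSubmodule.Quotient.mk v) := by
    intro j
    induction j with
    | zero => intro v; rfl
    | succ j ihj => intro v; rw [pow_succ, pow_succ, Module.End.mul_apply, ihj]; rfl
  have hmem : (toEnd K L V z ^ k) v ∈ W := by
    rw [← LieSubmodule.Quotient.mk_eq_zero]
    exact (hmk k v).trans (by rw [hk, LinearMap.zero_apply])
  have := congrArg Subtype.val (LinearMap.congr_fun (hact z hzI) ⟨_, hmem⟩)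
  rw [pow_succ', Module.End.mul_apply]
  simpa [hχz] using this

/-- In characteristic zero, `⁅L, I⁆` acts by nilpotent endomorphisms on every finite dimensional
`L`-module when `I` is a solvable ideal. -/
theorem isNilpotent_toEnd_of_mem_lie_top {F L : Type*} [Field F] [CharZero F]
    [LieRing L] [LieAlgebra F L] (I : LieIdeal F L) [IsSolvable I] {z : L}
    (hz : z ∈ ⁅(⊤ : LieIdeal F L), I⁆) (V : Type*) [AddCommGroup V] [Module F V]
    [FiniteDimensional F V] [LieRingModule L V] [LieModule F L V] :
    _root_.IsNilpotent (toEnd F L V z) := by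
  let A := AlgebraicClosure F
  have hI : IsSolvable (LieSubmodule.baseChange A I : LieIdeal A (A ⊗[F] L)) := by
    obtain ⟨k, hk⟩ := IsSolvable.solvable F I
    rw [LieIdeal.derivedSeries_eq_bot_iff] at hk
    refine IsSolvable.mk (R := A) (k := k) ((LieIdeal.derivedSeries_eq_bot_iff _ k).mpr ?_)
    rw [derivedSeriesOfIdeal_baseChange, hk, LieSubmodule.baseChange_bot]
  have hz' : (1 : A) ⊗ₜ[F] z ∈
      ⁅(⊤ : LieIdeal A (A ⊗[F] L)), (LieSubmodule.baseChange A I : LieIdeal A (A ⊗[F] L))⁆ := by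
    rw [← LieSubmodule.baseChange_top, ← LieSubmodule.lie_baseChange]
    exact LieSubmodule.tmul_mem_baseChange_of_mem 1 hz
  have h := isNilpotent_toEnd_of_mem_lie_top_of_isAlgClosed _ hz' (A ⊗[F] V)
  rw [toEnd_baseChange] at h
  -- Nilpotency descends from the algebraic closure because extension of scalars is injective on
  -- endomorphisms.
  have hinj : Function.Injective (Module.End.baseChangeHom F A V) :=
    LinearMap.baseChangeHom_injective F V A
  exact (IsNilpotent.map_iff hinj).1 h

end LieModule

/-! ### The two radicals through brackets and traces -/

namespace LieAlgebra

variable {F L : Type*} [Field F] [LieRing L] [LieAlgebra F L]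

theorem isSolvable_of_isNilpotent_ideal (I : LieIdeal F L) (h : LieRing.IsNilpotent I) :
    IsSolvable I :=
  haveI := h
  inferInstance

theorem nilpotentRadical_le_radical : nilpotentRadical F L ≤ radical F L :=
  sSup_le_sSup fun I hI ↦ isSolvable_of_isNilpotent_ideal I hI

theorem lie_top_radical_le_nilpotentRadical [CharZero F] [FiniteDimensional F L] :
    ⁅(⊤ : LieIdeal F L), radical F L⁆ ≤ nilpotentRadical F L := by
  refine le_sSup ?_
  change LieRing.IsNilpotent _
  rw [LieAlgebra.isNilpotent_iff_forall (R := F)]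
  rintro ⟨x, hx⟩
  exact LieSubalgebra.isNilpotent_ad_of_isNilpotent_ad
    ((⁅(⊤ : LieIdeal F L), radical F L⁆ : LieIdeal F L) : LieSubalgebra F L) (x := ⟨x, hx⟩)
    (LieModule.isNilpotent_toEnd_of_mem_lie_top (radical F L) hx L)

/-- The radical consists of the elements that are central modulo the nilpotent radical. -/
theorem mem_radical_iff_forall_lie_mem_nilpotentRadical [CharZero F] [FiniteDimensional F L]
    {a : L} : a ∈ radical F L ↔ ∀ y : L, ⁅a, y⁆ ∈ nilpotentRadical F L := by
  refine ⟨fun ha y ↦ ?_, fun ha ↦ ?_⟩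
  · rw [← lie_skew]
    exact neg_mem (lie_top_radical_le_nilpotentRadical
      (LieSubmodule.lie_mem_lie (LieSubmodule.mem_top y) ha))
  · let J : LieIdeal F L :=
      { carrier := {b | ∀ y : L, ⁅b, y⁆ ∈ nilpotentRadical F L}
        add_mem' := fun hb hc y ↦ by rw [add_lie]; exact add_mem (hb y) (hc y)
        zero_mem' := fun y ↦ by rw [zero_lie]; exact zero_mem _
        smul_mem' := fun c b hb y ↦ by rw [smul_lie]; exact Submodule.smul_mem _ c (hb y)
        lie_mem := fun {x b} hb y ↦ by
          rw [lie_lie]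
          exact sub_mem (lie_mem_right F L _ x _ (hb y)) (hb _) }
    -- `J` is central modulo the nilpotent radical, so one more derived step than for the radical
    -- kills it.
    have hJJ : ⁅J, J⁆ ≤ radical F L :=
      ((LieSubmodule.lie_le_iff _ _ _).2 fun x hx y _ ↦ hx y : ⁅J, J⁆ ≤ nilpotentRadical F L).trans
        nilpotentRadical_le_radical
    have hJ : IsSolvable J := by
      obtain ⟨k, hk⟩ := IsSolvable.solvable F (radical F L)
      rw [LieIdeal.derivedSeries_eq_bot_iff] at hk
      refine IsSolvable.mk (R := F) (k := k + 1) ((LieIdeal.derivedSeries_eq_bot_iff _ _).mpr ?_)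
      rw [derivedSeriesOfIdeal_add, derivedSeriesOfIdeal_succ, derivedSeriesOfIdeal_zero, eq_bot_iff,
        ← hk]
      exact derivedSeriesOfIdeal_mono hJJ k
    exact (LieIdeal.solvable_iff_le_radical F L J).1 hJ ha

variable (F L) in
/-- The associative algebra of endomorphisms of `L` generated by the inner derivations. -/
def adjoinAd : Subalgebra F (Module.End F L) :=
  Algebra.adjoin F (Set.range (ad F L))

theorem ad_mem_adjoinAd (x : L) : ad F L x ∈ adjoinAd F L :=
  Algebra.subset_adjoin ⟨x, rfl⟩

theorem apply_mem_of_mem_adjoinAd {u : Module.End F L} (hu : u ∈ adjoinAd F L) (I : LieIdeal F L)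
    {x : L} (hx : x ∈ I) : u x ∈ I := by
  induction hu using Algebra.adjoin_induction generalizing x with
  | mem u hu => obtain ⟨y, rfl⟩ := hu; exact lie_mem_right F L I y x hx
  | algebraMap r => exact Submodule.smul_mem _ r hx
  | add u v _ _ hu hv => exact add_mem (hu hx) (hv hx)
  | mul u v _ _ hu hv => exact hu (hv hx)

/-- `ad a * u` is nilpotent: `u` preserves every ideal, and `ad a` moves each term of the series
`I.lcs L` into the next. -/
theorem trace_ad_mul_eq_zero_of_isNilpotent [FiniteDimensional F L] (I : LieIdeal F L)
    (hI : LieRing.IsNilpotent I) {a : L} (ha : a ∈ I) {u : Module.End F L}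
    (hu : u ∈ adjoinAd F L) : LinearMap.trace F L (ad F L a * u) = 0 := by
  have hnil : LieModule.IsNilpotent I L := by
    rw [LieModule.isNilpotent_iff_forall' (R := F)]
    intro x
    obtain ⟨k, hk⟩ := (LieAlgebra.isNilpotent_iff_forall (R := F)).1 hI x
    -- The extra application brings `L` into `I`, where the nilpotency of `I` takes over.
    refine ⟨k + 1, ?_⟩
    ext y
    have hpow : ∀ j (w : I), (LieModule.toEnd F I L x ^ j) (w : L) = ((ad F I x ^ j) w : I) := by
      intro j
      induction j with
      | zero => intro w; rfl
      | succ j ihj =>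
        intro w
        rw [pow_succ, pow_succ, Module.End.mul_apply, Module.End.mul_apply, ← ihj]
        rfl
    have hxy : ⁅(x : L), y⁆ ∈ I := lie_mem_left F L I x y x.2
    rw [pow_succ, Module.End.mul_apply]
    exact (hpow k ⟨_, hxy⟩).trans (by rw [hk]; rfl)
  obtain ⟨k, hk⟩ := (LieModule.isNilpotent_iff F I L).1 hnil
  have hlcs : I.lcs L k = ⊥ := by
    rw [← LieSubmodule.toSubmodule_eq_bot, LieIdeal.coe_lcs_eq, hk]; rfl
  have hmem : ∀ j (y : L), ((ad F L a * u) ^ j) y ∈ I.lcs L j := by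
    intro j
    induction j with
    | zero => intro y; rw [LieIdeal.lcs_zero]; exact LieSubmodule.mem_top _
    | succ j ihj =>
      intro y
      rw [pow_succ', Module.End.mul_apply, LieIdeal.lcs_succ]
      exact LieSubmodule.lie_mem_lie ha (apply_mem_of_mem_adjoinAd hu (I.lcs L j) (ihj y))
  refine (LinearMap.isNilpotent_trace_of_isNilpotent ⟨k, ?_⟩).eq_zero
  ext y
  simpa [hlcs] using hmem k y

/-- The nilpotent radical is the kernel of the trace pairing between `L` and the associative algebra
generated by the inner derivations. -/
theorem mem_nilpotentRadical_iff [CharZero F] [FiniteDimensional F L] {a : L} :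
    a ∈ nilpotentRadical F L ↔
      ∀ u ∈ adjoinAd F L, LinearMap.trace F L (ad F L a * u) = 0 := by
  let M : LieIdeal F L :=
    { carrier := {b | ∀ u ∈ adjoinAd F L, LinearMap.trace F L (ad F L b * u) = 0}
      add_mem' := fun {b c} hb hc u hu ↦ by
        rw [map_add, add_mul, map_add, hb u hu, hc u hu, add_zero]
      zero_mem' := fun u _ ↦ by rw [map_zero, zero_mul, map_zero]
      smul_mem' := fun c b hb u hu ↦ by rw [map_smul, smul_mul_assoc, map_smul, hb u hu, smul_zero]
      lie_mem := fun {x b} hb u hu ↦ by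
        have h1 := hb _ (mul_mem hu (ad_mem_adjoinAd x))
        have h2 := hb _ (mul_mem (ad_mem_adjoinAd x) hu)
        have hlie : ad F L ⁅x, b⁆ = ad F L x * ad F L b - ad F L b * ad F L x := by
          ext y
          simp
        rw [hlie, sub_mul, map_sub, mul_assoc, mul_assoc,
          LinearMap.trace_mul_comm, mul_assoc, h1, h2, sub_zero] }
  suffices nilpotentRadical F L = M by rw [this]; rfl
  refine le_antisymm (sSup_le fun I hI a ha u hu ↦
    trace_ad_mul_eq_zero_of_isNilpotent I hI ha hu) (le_sSup ?_)
  change LieRing.IsNilpotent M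
  rw [LieAlgebra.isNilpotent_iff_forall (R := F)]
  rintro ⟨x, hx⟩
  refine LieSubalgebra.isNilpotent_ad_of_isNilpotent_ad (M : LieSubalgebra F L) (x := ⟨x, hx⟩) ?_
  refine LinearMap.isNilpotent_of_forall_trace_pow_eq_zero _ fun k ↦ ?_
  rw [pow_succ']
  exact hx _ (pow_mem (ad_mem_adjoinAd x) k)

end LieAlgebra

/-! ### Slices of tensors and coefficient matrices of comodules -/

noncomputable section

namespace TensorProduct

variable {F V H ι : Type*} [Field F] [AddCommGroup V] [Module F V] [AddCommGroup H] [Module F H]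

variable (H) in
/-- The map `V ⊗ H → H` that applies a linear functional to the first tensor factor. -/
def slice (g : V →ₗ[F] F) : V ⊗[F] H →ₗ[F] H :=
  (TensorProduct.lid F H).toLinearMap ∘ₗ g.rTensor H

@[simp]
theorem slice_tmul (g : V →ₗ[F] F) (v : V) (h : H) : slice H g (v ⊗ₜ[F] h) = g v • h := by
  simp [slice]

theorem sum_tmul_slice_coord [Fintype ι] (v : Module.Basis ι F V) (x : V ⊗[F] H) :
    ∑ i, v i ⊗ₜ[F] slice H (v.coord i) x = x := by
  induction x with
  | zero => simp
  | add x y hx hy => simp only [map_add, tmul_add, Finset.sum_add_distrib, hx, hy]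
  | tmul a h =>
    simp only [slice_tmul, tmul_smul, smul_tmul', ← sum_tmul]
    simp [v.sum_repr]

/-- A tensor lies in `W ⊗ H` as soon as it is killed by a family of functionals defining `W`. -/
theorem mem_range_rTensor_of_forall_slice_eq_zero (W : Submodule F V) (S : Set (V →ₗ[F] F))
    (hS : ∀ w, (∀ g ∈ S, g w = 0) → w ∈ W) {x : V ⊗[F] H} (hx : ∀ g ∈ S, slice H g x = 0) :
    x ∈ LinearMap.range (W.subtype.rTensor H) := by
  classical
  let B := Module.Basis.ofVectorSpace F H
  -- Expanding along a basis of `H` reduces membership in `W ⊗ H` to membership of each coefficient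
  -- in `W`.
  set c := equivFinsuppOfBasisRight (M := V) B x with hc
  have hxc : x = c.sum fun l w ↦ w ⊗ₜ[F] B l := by
    rw [← equivFinsuppOfBasisRight_symm_apply, hc, LinearEquiv.symm_apply_apply]
  have hW : ∀ l, c l ∈ W := by
    refine fun l ↦ hS _ fun g hg ↦ ?_
    have h0 := hx g hg
    rw [hxc, Finsupp.sum, map_sum] at h0
    simp only [slice_tmul] at h0
    by_cases hl : l ∈ c.support
    · exact linearIndependent_iff'.1 B.linearIndependent c.support (fun l ↦ g (c l)) h0 l hl
    · rw [Finsupp.notMem_support_iff.1 hl, map_zero]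
  rw [hxc]
  exact Submodule.sum_mem _ fun l _ ↦ ⟨⟨c l, hW l⟩ ⊗ₜ[F] B l, by simp⟩

theorem slice_eq_zero_of_mem_range_rTensor {W : Submodule F V} {g : V →ₗ[F] F}
    (hg : ∀ w ∈ W, g w = 0) {x : V ⊗[F] H} (hx : x ∈ LinearMap.range (W.subtype.rTensor H)) :
    slice H g x = 0 := by
  obtain ⟨y, rfl⟩ := hx
  induction y with
  | zero => simp
  | add y z hy hz => simp only [map_add, hy, hz, add_zero]
  | tmul w h => simp [hg w w.2]

end TensorProduct

open TensorProduct

namespace RightComodule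

variable {F H V ι : Type*} [Field F] [AddCommGroup V] [Module F V] [Fintype ι]

section Coalgebra

variable [AddCommGroup H] [Module F H] [Coalgebra F H]

/-- The matrix of coefficients of a comodule with respect to a basis. -/
def coeff (C : RightComodule F H V) (v : Module.Basis ι F V) : Matrix ι ι H :=
  Matrix.of fun i j ↦ slice H (v.coord i) (C.coact (v j))

theorem coact_basis (C : RightComodule F H V) (v : Module.Basis ι F V) (j : ι) :
    C.coact (v j) = ∑ i, v i ⊗ₜ[F] C.coeff v i j :=
  (sum_tmul_slice_coord v _).symm

theorem comul_coeff (C : RightComodule F H V) (v : Module.Basis ι F V) (i j : ι) :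
    Coalgebra.comul (R := F) (C.coeff v i j) = ∑ k, C.coeff v i k ⊗ₜ[F] C.coeff v k j := by
  classical
  have h := congrArg (slice (H ⊗[F] H) (v.coord i)) (LinearMap.congr_fun C.coact_coassoc (v j))
  simp only [LinearMap.comp_apply, coact_basis, map_sum, LinearMap.rTensor_tmul,
    LinearMap.lTensor_tmul, sum_tmul, LinearEquiv.coe_coe, assoc_tmul, slice_tmul,
    Module.Basis.coord_apply, Module.Basis.repr_self] at h
  simpa [Finsupp.single_apply] using h.symm

theorem counit_coeff [DecidableEq ι] (C : RightComodule F H V) (v : Module.Basis ι F V) (i j : ι) :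
    Coalgebra.counit (R := F) (C.coeff v i j) = (1 : Matrix ι ι F) i j := by
  have h := congrArg (v.coord i) (LinearMap.congr_fun C.coact_counit (v j))
  simpa [coact_basis, Finsupp.single_apply, Matrix.one_apply, eq_comm] using h

end Coalgebra

section HopfAlgebra

variable [Ring H] [HopfAlgebra F H] [DecidableEq ι]

theorem antipode_coeff_mul_coeff (C : RightComodule F H V) (v : Module.Basis ι F V) :
    (C.coeff v).map (HopfAlgebra.antipode F) * C.coeff v = 1 := by
  ext i j
  have h := HopfAlgebra.mul_antipode_rTensor_comul_apply (R := F) (C.coeff v i j)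
  rw [comul_coeff, counit_coeff] at h
  simpa [Matrix.mul_apply, Matrix.one_apply, apply_ite (algebraMap F H)] using h

theorem coeff_mul_antipode_coeff (C : RightComodule F H V) (v : Module.Basis ι F V) :
    C.coeff v * (C.coeff v).map (HopfAlgebra.antipode F) = 1 := by
  ext i j
  have h := HopfAlgebra.mul_antipode_lTensor_comul_apply (R := F) (C.coeff v i j)
  rw [comul_coeff, counit_coeff] at h
  simpa [Matrix.mul_apply, Matrix.one_apply, apply_ite (algebraMap F H)] using h

/-- When `S² = id`, the coefficient matrix is also inverted by `S` with the factors of each product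
contracted in the other index. -/
theorem sum_coeff_mul_antipode_coeff
    (hS : ∀ h : H, HopfAlgebra.antipode F (HopfAlgebra.antipode F h) = h)
    (C : RightComodule F H V) (v : Module.Basis ι F V) (i k : ι) :
    ∑ j, C.coeff v j i * HopfAlgebra.antipode F (C.coeff v k j) = (1 : Matrix ι ι H) k i := by
  have h := congrFun (congrFun (C.coeff_mul_antipode_coeff v) k) i
  rw [Matrix.mul_apply] at h
  -- Apply the anti-homomorphism `S` to the entries of `c · S(c) = 1`.
  calc ∑ j, C.coeff v j i * HopfAlgebra.antipode F (C.coeff v k j)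
      = HopfAlgebra.antipode F (∑ j, C.coeff v k j * HopfAlgebra.antipode F (C.coeff v j i)) := by
        simp [HopfAlgebra.antipode_mul_antidistrib, hS]
    _ = HopfAlgebra.antipode F ((1 : Matrix ι ι H) k i) := by rw [← h]; rfl
    _ = (1 : Matrix ι ι H) k i := by
        rw [Matrix.one_apply]
        split_ifs <;> simp

/-- When `S² = id`, conjugation by the coefficient matrix preserves the trace of a scalar matrix. -/
theorem trace_coeff_mul_map_mul_antipode_coeff
    (hS : ∀ h : H, HopfAlgebra.antipode F (HopfAlgebra.antipode F h) = h)
    (C : RightComodule F H V) (v : Module.Basis ι F V) (M : Matrix ι ι F) (h : H) :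
    (C.coeff v * M.map (algebraMap F H) * (C.coeff v).map (HopfAlgebra.antipode F) *
      Matrix.scalar ι h).trace = algebraMap F H M.trace * h := by
  -- The trace is not cyclic over noncommutative `H`; the contraction coming from `S² = id` replaces
  -- cyclicity.
  have key : ∀ i k, ∑ j, C.coeff v j i * algebraMap F H (M i k) *
      HopfAlgebra.antipode F (C.coeff v k j) = algebraMap F H (M i k) * (1 : Matrix ι ι H) k i := by
    intro i k
    rw [← C.sum_coeff_mul_antipode_coeff hS v, Finset.mul_sum]
    refine Finset.sum_congr rfl fun j _ ↦ ?_
    rw [← Algebra.commutes, mul_assoc]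
  have htr : (C.coeff v * M.map (algebraMap F H) *
      (C.coeff v).map (HopfAlgebra.antipode F)).trace = algebraMap F H M.trace := by
    simp only [Matrix.trace, Matrix.diag_apply, Matrix.mul_apply, Matrix.map_apply, Finset.sum_mul]
    rw [Finset.sum_comm, map_sum]
    refine Finset.sum_congr rfl fun k _ ↦ ?_
    rw [Finset.sum_comm]
    simp only [key, Matrix.one_apply, mul_ite, mul_one, mul_zero, Finset.sum_ite_eq,
      Finset.mem_univ, if_true]
  rw [← htr]
  rw [Matrix.trace, Matrix.trace, Finset.sum_mul]
  refine Finset.sum_congr rfl fun i _ ↦ ?_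
  rw [Matrix.diag_apply, Matrix.scalar_apply, Matrix.mul_diagonal, Matrix.diag_apply]

end HopfAlgebra

end RightComodule

end

/-! ### Conjugation by the coefficient matrix and stability of the radicals -/

noncomputable section

open TensorProduct LieAlgebra

namespace ComoduleLieAlgebra

variable {F H L ι : Type*} [Field F] [Ring H] [HopfAlgebra F H] [LieRing L] [LieAlgebra F L]
  [Fintype ι]

theorem coact_lie_basis (C : ComoduleLieAlgebra F H L) (v : Module.Basis ι F L) (a : L) (l : ι) :
    C.coact ⁅a, v l⁆ =
      ∑ i, ∑ p, ⁅v i, v p⁆ ⊗ₜ[F] (slice H (v.coord i) (C.coact a) * C.coeff v p l) := by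
  rw [C.coact_lie, C.coact_basis]
  nth_rewrite 1 [← sum_tmul_slice_coord v (C.coact a)]
  simp only [sum_tmul, tmul_sum, map_sum, lieTensorMul_tmul]
  exact Finset.sum_comm

variable [DecidableEq ι]

variable (H) in
/-- The matrix of an endomorphism of `L`, with entries in `H`. -/
def endMatrix (v : Module.Basis ι F L) : Module.End F L →ₐ[F] Matrix ι ι H :=
  (Algebra.ofId F H).mapMatrix.comp (LinearMap.toMatrixAlgEquiv v).toAlgHom

theorem endMatrix_eq_map (v : Module.Basis ι F L) (u : Module.End F L) :
    endMatrix H v u = (LinearMap.toMatrix v v u).map (algebraMap F H) := rfl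

theorem endMatrix_apply (v : Module.Basis ι F L) (u : Module.End F L) (i j : ι) :
    endMatrix H v u i j = algebraMap F H (v.coord i (u (v j))) := by
  rw [endMatrix_eq_map, Matrix.map_apply, LinearMap.toMatrix_apply, Module.Basis.coord_apply]

theorem trace_endMatrix (v : Module.Basis ι F L) (u : Module.End F L) :
    (endMatrix H v u).trace = algebraMap F H (LinearMap.trace F L u) := by
  rw [LinearMap.trace_eq_matrix_trace F v, endMatrix_eq_map]
  simp [Matrix.trace]

theorem scalar_mul_endMatrix (v : Module.Basis ι F L) (u : Module.End F L) (h : H) :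
    Matrix.scalar ι h * endMatrix H v u = endMatrix H v u * Matrix.scalar ι h := by
  ext i j
  simp only [Matrix.scalar_apply, Matrix.diagonal_mul, Matrix.mul_diagonal, endMatrix_apply]
  exact (Algebra.commutes _ _).symm

/-- The matrix with entries in `H` of the coaction of `a` composed with the adjoint representation,
i.e. of `ad a₀ ⊗ a₁`. -/
def coactAdMatrix (C : ComoduleLieAlgebra F H L) (v : Module.Basis ι F L) (a : L) : Matrix ι ι H :=
  ∑ i, endMatrix H v (ad F L (v i)) * Matrix.scalar ι (slice H (v.coord i) (C.coact a))

theorem coeff_mul_endMatrix_ad (C : ComoduleLieAlgebra F H L) (v : Module.Basis ι F L) (a : L) :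
    C.coeff v * endMatrix H v (ad F L a) = C.coactAdMatrix v a * C.coeff v := by
  ext m l
  have hl : (C.coeff v * endMatrix H v (ad F L a)) m l =
      slice H (v.coord m) (C.coact ⁅a, v l⁆) := by
    conv_rhs => rw [← v.sum_repr ⁅a, v l⁆]
    simp only [map_sum, map_smul, Matrix.mul_apply, endMatrix_apply, ad_apply,
      Module.Basis.coord_apply]
    refine Finset.sum_congr rfl fun p _ ↦ ?_
    rw [← Algebra.commutes, ← Algebra.smul_def]
    rfl
  rw [hl, coact_lie_basis, coactAdMatrix, Finset.sum_mul, Matrix.sum_apply, map_sum]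
  refine Finset.sum_congr rfl fun i _ ↦ ?_
  rw [Matrix.mul_apply, map_sum]
  refine Finset.sum_congr rfl fun p _ ↦ ?_
  rw [slice_tmul, Matrix.scalar_apply, Matrix.mul_diagonal, endMatrix_apply, Algebra.smul_def,
    mul_assoc, ad_apply]

theorem coactAdMatrix_eq (C : ComoduleLieAlgebra F H L) (v : Module.Basis ι F L) (a : L) :
    C.coactAdMatrix v a = C.coeff v * endMatrix H v (ad F L a) *
      (C.coeff v).map (HopfAlgebra.antipode F) := by
  rw [coeff_mul_endMatrix_ad, mul_assoc, C.coeff_mul_antipode_coeff, mul_one]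

/-- Inverts the coaction: `c · S(c) = 1` recovers `ad (v j)` from the conjugated matrices. -/
theorem endMatrix_ad_basis (C : ComoduleLieAlgebra F H L) (v : Module.Basis ι F L) (j : ι) :
    endMatrix H v (ad F L (v j)) = ∑ i, C.coactAdMatrix v (v i) *
      Matrix.scalar ι (HopfAlgebra.antipode F (C.coeff v i j)) := by
  have key : ∀ k, ∑ i, C.coeff v k i * HopfAlgebra.antipode F (C.coeff v i j) =
      (1 : Matrix ι ι H) k j := fun k ↦ by
    rw [← C.coeff_mul_antipode_coeff v, Matrix.mul_apply]; rfl
  have hc : ∀ k i, slice H (v.coord k) (C.coact (v i)) = C.coeff v k i := fun _ _ ↦ rfl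
  simp only [coactAdMatrix, Finset.sum_mul, mul_assoc, ← map_mul, hc]
  rw [Finset.sum_comm]
  simp only [← Finset.mul_sum, ← map_sum, key]
  rw [Finset.sum_eq_single j]
  · rw [Matrix.one_apply_eq, map_one, mul_one]
  · intro k _ hk
    rw [Matrix.one_apply_ne hk, map_zero, mul_zero]
  · simp

/-- The span of the matrices `C · (ad a ∘ w) · S(C) · h`, where `w` runs through the associative
algebra generated by the inner derivations. -/
def conjSpan (C : ComoduleLieAlgebra F H L) (v : Module.Basis ι F L) (a : L) :
    Submodule F (Matrix ι ι H) :=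
  Submodule.span F {X | ∃ w ∈ adjoinAd F L, ∃ h : H,
    C.coeff v * endMatrix H v (ad F L a * w) * (C.coeff v).map (HopfAlgebra.antipode F) *
      Matrix.scalar ι h = X}

theorem mul_endMatrix_ad_mem_conjSpan (C : ComoduleLieAlgebra F H L) (v : Module.Basis ι F L)
    (a b : L) {X : Matrix ι ι H} (hX : X ∈ C.conjSpan v a) :
    X * endMatrix H v (ad F L b) ∈ C.conjSpan v a := by
  induction hX using Submodule.span_induction with
  | zero => rw [zero_mul]; exact zero_mem _
  | add X Y _ _ hX hY => rw [add_mul]; exact add_mem hX hY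
  | smul c X _ hX => rw [smul_mul_assoc]; exact Submodule.smul_mem _ c hX
  | mem X hX =>
    obtain ⟨w, hw, h, rfl⟩ := hX
    rw [← v.sum_repr b]
    simp only [map_sum, map_smul, Finset.mul_sum, mul_smul_comm]
    refine Submodule.sum_mem _ fun j _ ↦ Submodule.smul_mem _ _ ?_
    -- Once `ad (v j)` is written through conjugates, the inner `S(c) · c` cancels and `w` becomes
    -- `w * ad (v i)`.
    rw [mul_assoc _ (Matrix.scalar ι h), scalar_mul_endMatrix, C.endMatrix_ad_basis, ← mul_assoc,
      Finset.mul_sum, Finset.sum_mul]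
    refine Submodule.sum_mem _ fun i _ ↦ Submodule.subset_span
      ⟨w * ad F L (v i), mul_mem hw (ad_mem_adjoinAd _),
        HopfAlgebra.antipode F (C.coeff v i j) * h, ?_⟩
    rw [coactAdMatrix_eq, map_mul, map_mul, map_mul, map_mul]
    simp only [mul_assoc]
    rw [← mul_assoc ((C.coeff v).map (HopfAlgebra.antipode F)) (C.coeff v),
      C.antipode_coeff_mul_coeff, one_mul]

theorem mul_endMatrix_mem_conjSpan (C : ComoduleLieAlgebra F H L) (v : Module.Basis ι F L)
    (a : L) {u : Module.End F L} (hu : u ∈ adjoinAd F L) {X : Matrix ι ι H}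
    (hX : X ∈ C.conjSpan v a) : X * endMatrix H v u ∈ C.conjSpan v a := by
  induction hu using Algebra.adjoin_induction generalizing X with
  | mem u hu => obtain ⟨b, rfl⟩ := hu; exact C.mul_endMatrix_ad_mem_conjSpan v a b hX
  | algebraMap r =>
    rw [AlgHom.commutes, ← Algebra.commutes, ← Algebra.smul_def]
    exact Submodule.smul_mem _ r hX
  | add u u' _ _ hu hu' => rw [map_add, mul_add]; exact add_mem (hu hX) (hu' hX)
  | mul u u' _ _ hu hu' => rw [map_mul, ← mul_assoc]; exact hu' (hu hX)

theorem coactAdMatrix_mem_conjSpan (C : ComoduleLieAlgebra F H L) (v : Module.Basis ι F L)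
    (a : L) : C.coactAdMatrix v a ∈ C.conjSpan v a :=
  Submodule.subset_span ⟨1, one_mem _, 1, by rw [mul_one, map_one, mul_one, coactAdMatrix_eq]⟩

/-- The linear functional `a ↦ tr (ad a ∘ u)`. -/
def traceAdMul (u : Module.End F L) : L →ₗ[F] F where
  toFun a := LinearMap.trace F L (ad F L a * u)
  map_add' a b := by rw [map_add, add_mul, map_add]
  map_smul' c a := by rw [map_smul, smul_mul_assoc, map_smul, RingHom.id_apply]

theorem trace_coactAdMatrix_mul (C : ComoduleLieAlgebra F H L) (v : Module.Basis ι F L) (a : L)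
    (u : Module.End F L) : (C.coactAdMatrix v a * endMatrix H v u).trace =
      slice H (traceAdMul u) (C.coact a) := by
  conv_rhs => rw [← sum_tmul_slice_coord v (C.coact a)]
  rw [coactAdMatrix, Finset.sum_mul, Matrix.trace_sum, map_sum]
  refine Finset.sum_congr rfl fun i _ ↦ ?_
  rw [mul_assoc, scalar_mul_endMatrix, ← mul_assoc, ← map_mul, slice_tmul, Algebra.smul_def]
  refine Eq.trans ?_ (congrArg (· * _) (trace_endMatrix v (ad F L (v i) * u)))
  rw [Matrix.trace, Matrix.trace, Finset.sum_mul]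
  refine Finset.sum_congr rfl fun k _ ↦ ?_
  rw [Matrix.diag_apply, Matrix.scalar_apply, Matrix.mul_diagonal, Matrix.diag_apply]

variable [CharZero F] [FiniteDimensional F L]

theorem trace_eq_zero_of_mem_conjSpan
    (hS : ∀ h : H, HopfAlgebra.antipode F (HopfAlgebra.antipode F h) = h)
    (C : ComoduleLieAlgebra F H L) (v : Module.Basis ι F L) {a : L}
    (ha : a ∈ nilpotentRadical F L) {X : Matrix ι ι H} (hX : X ∈ C.conjSpan v a) :
    X.trace = 0 := by
  induction hX using Submodule.span_induction with
  | zero => exact Matrix.trace_zero ι H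
  | add X Y _ _ hX hY => rw [Matrix.trace_add, hX, hY, add_zero]
  | smul c X _ hX => rw [Matrix.trace_smul, hX, smul_zero]
  | mem X hX =>
    obtain ⟨w, hw, h, rfl⟩ := hX
    rw [endMatrix_eq_map, C.trace_coeff_mul_map_mul_antipode_coeff hS,
      ← LinearMap.trace_eq_matrix_trace, mem_nilpotentRadical_iff.1 ha w hw, map_zero, zero_mul]

theorem isSubcomodule_nilpotentRadical
    (hS : ∀ h : H, HopfAlgebra.antipode F (HopfAlgebra.antipode F h) = h)
    (C : ComoduleLieAlgebra F H L) :
    C.IsSubcomodule (nilpotentRadical F L).toSubmodule := by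
  intro a ha
  refine mem_range_rTensor_of_forall_slice_eq_zero _
    (traceAdMul '' (adjoinAd F L : Set (Module.End F L))) ?_ ?_
  · intro w hw
    exact mem_nilpotentRadical_iff.2 fun u hu ↦ hw _ ⟨u, hu, rfl⟩
  · rintro _ ⟨u, hu, rfl⟩
    let v := Module.finBasis F L
    rw [← C.trace_coactAdMatrix_mul v]
    exact C.trace_eq_zero_of_mem_conjSpan hS v ha
      (C.mul_endMatrix_mem_conjSpan v a hu (C.coactAdMatrix_mem_conjSpan v a))

theorem isSubcomodule_radical
    (hS : ∀ h : H, HopfAlgebra.antipode F (HopfAlgebra.antipode F h) = h)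
    (C : ComoduleLieAlgebra F H L) :
    C.IsSubcomodule (radical F L).toSubmodule := by
  intro a ha
  let v := Module.finBasis F L
  -- These functionals cut out the radical, since functionals vanishing on the nilpotent radical
  -- separate it from outside elements.
  refine mem_range_rTensor_of_forall_slice_eq_zero _
    {f | ∃ (j : _) (g : L →ₗ[F] F), (∀ w ∈ nilpotentRadical F L, g w = 0) ∧
      f = g ∘ₗ (ad F L (v j)) } ?_ ?_
  · intro w hw
    refine mem_radical_iff_forall_lie_mem_nilpotentRadical.2 fun y ↦ ?_
    have hj : ∀ j, ⁅v j, w⁆ ∈ nilpotentRadical F L := by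
      intro j
      by_contra hn
      obtain ⟨g, hg, hg'⟩ := Submodule.exists_le_ker_of_notMem
        (p := (nilpotentRadical F L).toSubmodule) hn
      exact hg (hw _ ⟨j, g, fun w hw ↦ hg' hw, rfl⟩)
    rw [← lie_skew, ← v.sum_repr y, sum_lie]
    refine neg_mem (sum_mem fun j _ ↦ ?_)
    rw [smul_lie]
    exact Submodule.smul_mem _ _ (hj j)
  · rintro _ ⟨j, g, hg, rfl⟩
    have hrho : ∀ l, slice H g (C.coact ⁅a, v l⁆) = 0 := fun l ↦
      slice_eq_zero_of_mem_range_rTensor hg (C.isSubcomodule_nilpotentRadical hS _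
        (mem_radical_iff_forall_lie_mem_nilpotentRadical.1 ha (v l)))
    have key : ∀ p, ∑ l, C.coeff v p l * HopfAlgebra.antipode F (C.coeff v l j) =
        (1 : Matrix _ _ H) p j := fun p ↦ by
      rw [← C.coeff_mul_antipode_coeff v, Matrix.mul_apply]; rfl
    -- Multiplying by `S(c)` undoes the coaction on `v l`, leaving `g` applied to `[a₀, v j] ⊗ a₁`.
    have hsum : ∑ l, slice H g (C.coact ⁅a, v l⁆) * HopfAlgebra.antipode F (C.coeff v l j) =
        ∑ i, g ⁅v i, v j⁆ • slice H (v.coord i) (C.coact a) := by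
      simp only [coact_lie_basis, map_sum, slice_tmul, Finset.sum_mul, smul_mul_assoc, mul_assoc]
      rw [Finset.sum_comm]
      refine Finset.sum_congr rfl fun i _ ↦ ?_
      rw [Finset.sum_comm]
      simp only [← Finset.smul_sum, ← Finset.mul_sum, key]
      rw [Finset.sum_eq_single j]
      · rw [Matrix.one_apply_eq, mul_one]
      · intro k _ hk
        rw [Matrix.one_apply_ne hk, mul_zero, smul_zero]
      · simp
    rw [← sum_tmul_slice_coord v (C.coact a), map_sum]
    simp only [hrho, zero_mul, Finset.sum_const_zero] at hsum
    simp only [slice_tmul, LinearMap.comp_apply, ad_apply, ← lie_skew (v j), map_neg, neg_smul,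
      Finset.sum_neg_distrib, ← hsum, neg_zero]

end ComoduleLieAlgebra

end

theorem mainTheorem4 {F H L : Type*} [Field F] [CharZero F] [Ring H] [HopfAlgebra F H]
    (hS : ∀ h : H, HopfAlgebra.antipode F (HopfAlgebra.antipode F h) = h)
    [LieRing L] [LieAlgebra F L] [FiniteDimensional F L] (C : ComoduleLieAlgebra F H L) :
    C.IsSubcomodule (LieAlgebra.radical F L).toSubmodule ∧
      C.IsSubcomodule (LieAlgebra.nilpotentRadical F L).toSubmodule := by
  exact ⟨C.isSubcomodule_radical hS, C.isSubcomodule_nilpotentRadical hS⟩
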